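/- Theorem 4.3 (Rupprecht). Let $A\subseteq\mathbb N$ be an oracle. The following are equivalent. (i) There is a total function $f:\mathbb N\to\mathbb N$ with $f\le_T A$ such that for every total computable function $g:\mathbb N\to\mathbb N$ we have $f(n)\neq g(n)$ for all but finitely many $n$. (ii) $A$ is weakly meager engulfing, that is, there is an $A$-effectively meager set $\mathcal S\subseteq 2^{\mathbb N}$ that contains all computable elements of Cantor space $2^{\mathbb N}$. (ii') $A$ is weakly meager engulfing in the sense of Baire space, that is, there is an $A$-effectively meager set $\mathcal S\subseteq\mathbb N^{\mathbb N}$ that contains all computable elements of Baire space $\mathbb N^{\mathbb N}$. Here, for $X=2^{\mathbb N}$ or $X=\mathbb N^{\mathbb N}$ with the product topology of discrete spaces, a set $\mathcal S\subseteq X$ is called $A$-effectively meager if $\mathcal S\subseteq\bigcup_m\mathcal C_m$ for some sequence $(\mathcal C_m)_{m\in\mathbb N}$ of nowhere dense subsets of $X$ that are uniformly $\Pi^0_1(A)$, which means that there is a set $W$ of pairs $(m,\sigma)$ of a number $m$ and a finite string $\sigma$, recursively enumerable relative to $A$, such that for all $m$ the complement of $\mathcal C_m$ is the set of all $x\in X$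 that extend some $\sigma$ with $(m,\sigma)\in W$. -/

import Mathlib

/-- The characteristic function of a set of natural numbers, as an oracle. -/
noncomputable def oracleOf (A : Set ℕ) : ℕ →. ℕ :=
  ((A.indicator fun _ => 1 : ℕ → ℕ) : ℕ →. ℕ)

/-- A total function on the natural numbers is Turing reducible to the oracle `A`. -/
def ReducibleToSet (f : ℕ → ℕ) (A : Set ℕ) : Prop :=
  TuringReducible (f : ℕ →. ℕ) (oracleOf A)

/-- `f` eventually disagrees with `g`: `f n ≠ g n` for all but finitely many `n`. -/
def EventuallyDisagree (f g : ℕ → ℕ) : Prop :=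
  ∀ᶠ n in Filter.atTop, f n ≠ g n

/-- `A` computes a total function that eventually disagrees with every total computable
function. -/
def ComputesEventuallyDisagreeing (A : Set ℕ) : Prop :=
  ∃ f : ℕ → ℕ, ReducibleToSet f A ∧ ∀ g : ℕ → ℕ, Computable g → EventuallyDisagree f g

/-- `p` is recursively enumerable relative to `A`: it is the domain of a partial function that is
recursive in `A` (the relativization of `REPred`). -/
def REPredInSet {β : Type*} [Primcodable β] (A : Set ℕ) (p : β → Prop) : Prop :=
  RecursiveIn {oracleOf A} fun b => Part.assert (p b) fun _ => Part.some ()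

/-- The basic clopen set `[σ]` of all infinite sequences extending the string `σ`. -/
def stringCylinder {α : Type*} (σ : List α) : Set (ℕ → α) :=
  {x | ∀ (i : ℕ) (hi : i < σ.length), x i = σ[i]}

/-- The classes `C 0, C 1, …` of infinite sequences are uniformly `Π⁰₁` relative to `A`: their
complements are the open sets generated, uniformly in `m`, by an `A`-r.e. set of strings. -/
def UniformlyPiZeroOne {α : Type*} [Primcodable α] (A : Set ℕ) (C : ℕ → Set (ℕ → α)) : Prop :=
  ∃ W : ℕ × List α → Prop, REPredInSet A W ∧
    ∀ m, (C m)ᶜ = ⋃ σ ∈ {σ : List α | W (m, σ)}, stringCylinder σ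

/-- `S` is `A`-effectively meager: it is contained in a union of nowhere dense classes that are
uniformly `Π⁰₁` relative to `A`. The space `ℕ → α` carries the product topology. -/
def EffectivelyMeagerIn {α : Type*} [Primcodable α] [TopologicalSpace α]
    (A : Set ℕ) (S : Set (ℕ → α)) : Prop :=
  ∃ C : ℕ → Set (ℕ → α), UniformlyPiZeroOne A C ∧ (∀ m, IsNowhereDense (C m)) ∧ S ⊆ ⋃ m, C m

/-- `A` is weakly meager engulfing in the space `ℕ → α` (Cantor space for `α = Bool`, Baire space
for `α = ℕ`): some `A`-effectively meager set contains all computable points. -/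
def WeaklyMeagerEngulfing (α : Type*) [Primcodable α] [TopologicalSpace α] (A : Set ℕ) : Prop :=
  ∃ S : Set (ℕ → α), EffectivelyMeagerIn A S ∧ ∀ x : ℕ → α, Computable x → x ∈ S

/-! (i) to (ii): given `f`, let `C m` be the points `x` such that for no `n ≥ m` the bits of `x`
from position `n` on start with `f n` zeros and a one. Any string can be extended by such a block,
so `C m` is nowhere dense. If a computable `x` has infinitely many ones, the distance from `n` to
the next one is computable and eventually differs from `f n`; otherwise `x` is eventually zero.
Either way `x` lies in some `C m`.

(ii) to (ii'): pull the classes back along the coordinatewise parity map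
(`WeaklyMeagerEngulfing.nat_of_bool`).

(ii') to (i), by contraposition: suppose every `A`-computable function agrees infinitely often with
some computable one. Density of the complements gives `A`-computable operators `E k` such that every
point extending `σ ++ E k σ` avoids `C 0, …, C k` (`exists_extension_operators`). A computable point
is built along guessed finite tables of the `E k`. Two things must succeed at the same stage: a
computable size bound must be large enough (`exists_sparse`), and the guess must be right
(`exists_guess_on`). This happens infinitely often, so the point escapes every `C m`. -/

/-! ### Closure properties of computability relative to oracles. -/

section OracleComputability

variable {α β γ σ : Type*} [Primcodable α] [Primcodable β] [Primcodable γ] [Primcodable σ]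
variable {O : Set (ℕ →. ℕ)}

open Encodable Part

namespace RecursiveIn

theorem comp {f : β →. σ} {g : α → β} (hf : RecursiveIn O f) (hg : ComputableIn O g) :
    RecursiveIn O fun a => f (g a) :=
  (Nat.RecursiveIn.comp hf hg).of_eq fun n => by
    simp only [map_some, bind_eq_bind]
    rcases e : decode (α := α) n with - | a <;> simp [encodek]

protected theorem bind {f : α →. β} {g : α → β →. σ} (hf : RecursiveIn O f)
    (hg : RecursiveIn₂ O g) : RecursiveIn O fun a => (f a).bind (g a) :=
  (Nat.RecursiveIn.comp hg (Nat.RecursiveIn.pair Nat.Partrec.some.recursiveIn hf)).of_eq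
    fun n => by
      rcases e : decode (α := α) n with - | a
      · simp [Seq.seq]
      · simpa [Seq.seq, e, encodek] using (Part.map_bind (g a) (f a) encode).symm

theorem map {f : α →. β} {g : α → β → σ} (hf : RecursiveIn O f) (hg : ComputableIn₂ O g) :
    RecursiveIn O fun a => (f a).map (g a) := by
  simpa [bind_some_eq_map] using RecursiveIn.bind (g := fun a x => some (g a x)) hf hg

theorem nat_rec {f : α → ℕ} {g : α →. σ} {h : α → ℕ × σ →. σ} (hf : ComputableIn O f)
    (hg : RecursiveIn O g) (hh : RecursiveIn₂ O h) :
    RecursiveIn O fun a => (f a).rec (g a) fun y IH => IH.bind fun i => h a (y, i) :=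
  (Nat.RecursiveIn.comp (Nat.RecursiveIn.prec hg hh)
    (Nat.RecursiveIn.pair Nat.Partrec.some.recursiveIn hf)).of_eq fun n => by
    rcases e : decode (α := α) n with - | a
    · simp [Seq.seq]
    · simp only [coe_some, bind_some]
      simp [Seq.seq, e]
      induction f a <;> simp_all

theorem rfind {p : α → ℕ →. Bool} (hp : RecursiveIn₂ O p) :
    RecursiveIn O fun a => Nat.rfind (p a) :=
  (Nat.RecursiveIn.rfind <|
    RecursiveIn.map hp
      -- The underlying search looks for the value zero, so `true` is sent to 0.
      ((Primrec.dom_bool fun b => cond b 0 1).comp Primrec.snd).to₂.computableIn₂).of_eq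
    fun n => by
    rcases e : decode (α := α) n with - | a
    · simpa [e] using Nat.rfind_zero_none (fun _ => Part.none) rfl
    · simp [e, map_map, map_id']

end RecursiveIn

namespace ComputableIn

theorem of_eq {f g : α → σ} (hf : ComputableIn O f) (H : ∀ n, f n = g n) : ComputableIn O g :=
  (funext H : f = g) ▸ hf

theorem to₂ {f : α × β → σ} (hf : ComputableIn O f) : ComputableIn₂ O fun a b => f (a, b) := hf

theorem comp {f : β → σ} {g : α → β} (hf : ComputableIn O f) (hg : ComputableIn O g) :
    ComputableIn O fun a => f (g a) :=
  RecursiveIn.comp (f := fun b => Part.some (f b)) hf hg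

theorem pair {f : α → β} {g : α → γ} (hf : ComputableIn O f) (hg : ComputableIn O g) :
    ComputableIn O fun a => (f a, g a) :=
  (Nat.RecursiveIn.pair hf hg).of_eq fun n => by
    rcases e : decode (α := α) n <;> simp [Seq.seq]

end ComputableIn

theorem ComputableIn₂.comp {f : β → γ → σ} {g : α → β} {h : α → γ} (hf : ComputableIn₂ O f)
    (hg : ComputableIn O g) (hh : ComputableIn O h) : ComputableIn O fun a => f (g a) (h a) :=
  ComputableIn.comp hf (hg.pair hh)

theorem Primrec₂.compIn {f : β → γ → σ} {g : α → β} {h : α → γ} (hf : Primrec₂ f)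
    (hg : ComputableIn O g) (hh : ComputableIn O h) : ComputableIn O fun a => f (g a) (h a) :=
  hf.computableIn₂.comp hg hh

theorem Primrec.compIn {f : β → σ} {g : α → β} (hf : Primrec f) (hg : ComputableIn O g) :
    ComputableIn O fun a => f (g a) :=
  hf.computableIn.comp hg

namespace ComputableIn

theorem nat_rec {f : α → ℕ} {g : α → σ} {h : α → ℕ × σ → σ} (hf : ComputableIn O f)
    (hg : ComputableIn O g) (hh : ComputableIn₂ O h) :
    ComputableIn O fun a => Nat.rec (motive := fun _ => σ) (g a) (fun y IH => h a (y, IH)) (f a) :=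
  (RecursiveIn.nat_rec hf hg hh.recursiveIn₂).of_eq fun a => by
    dsimp only
    induction f a with
    | zero => rfl
    | succ n ih =>
      dsimp only
      rw [ih]
      exact bind_some _ _

theorem list_range_map {f : α → ℕ} {g : α → ℕ → σ} (hf : ComputableIn O f)
    (hg : ComputableIn₂ O g) : ComputableIn O fun a => (List.range (f a)).map (g a) :=
  (nat_rec (h := fun a p => p.2 ++ [g a p.1]) hf (ComputableIn.const [])
    ((Primrec.list_concat.computableIn₂.comp (ComputableIn.snd.comp ComputableIn.snd)
      (hg.comp ComputableIn.fst (ComputableIn.fst.comp ComputableIn.snd))))).of_eq fun a => by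
    induction f a with
    | zero => rfl
    | succ n ih => simp only [ih, List.range_succ, List.map_append, List.map_cons, List.map_nil]

theorem exists_find {p : α → ℕ → Bool} (hp : ComputableIn₂ O p) (H : ∀ a, ∃ n, p a n) :
    ∃ f : α → ℕ, ComputableIn O f ∧ ∀ a, p a (f a) ∧ ∀ m < f a, ¬ p a m := by
  classical
  refine ⟨fun a => Nat.find (H a), ?_, fun a => ⟨Nat.find_spec (H a), fun m => Nat.find_min (H a)⟩⟩
  refine (RecursiveIn.rfind hp.recursiveIn₂).of_eq_tot fun a => ?_
  refine Nat.mem_rfind.2 ⟨?_, fun {m} hm => ?_⟩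
  · simpa using Nat.find_spec (H a)
  · simpa using Nat.find_min (H a) hm

/-- Unbounded search over an inhabited type. -/
theorem exists_choice [Inhabited β] {p : α → β → Bool} (hp : ComputableIn₂ O p)
    (H : ∀ a, ∃ b, p a b) : ∃ f : α → β, ComputableIn O f ∧ ∀ a, p a (f a) := by
  -- Numbers that code nothing stand for `default`. This is harmless: the search accepts only what
  -- satisfies `p`.
  have hd : ComputableIn O fun n : ℕ => (decode (α := β) n).getD default :=
    (Primrec.option_getD_default.comp Primrec.decode).computableIn
  obtain ⟨f, hf, hpf⟩ := exists_find (p := fun a n => p a ((decode n).getD default))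
    (hp.comp ComputableIn.fst (hd.comp ComputableIn.snd)).to₂ fun a => by
      obtain ⟨b, hb⟩ := H a
      exact ⟨encode b, by simpa using hb⟩
  exact ⟨_, hd.comp hf, fun a => (hpf a).1⟩

end ComputableIn

end OracleComputability

/-! ### Stage approximations and relative recursive enumerability. -/

section Approximation

open Encodable Filter

/-- A sequence of total `O`-computable functions that converges to the partial function `f`:
values are never wrong, and every value of `f` is eventually found. -/
structure Approximates (O : Set (ℕ →. ℕ)) (f : ℕ →. ℕ) (e : ℕ → ℕ → Option ℕ) : Prop where
  computableIn : ComputableIn₂ O e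
  sound : ∀ {k n x}, e k n = some x → x ∈ f n
  complete : ∀ {n x}, x ∈ f n → ∀ᶠ k in atTop, e k n = some x

theorem Approximates.of_total {O : Set (ℕ →. ℕ)} {f : ℕ → ℕ} (hf : ComputableIn O f) :
    Approximates O f fun _ n => some (f n) where
  computableIn := Primrec.option_some.computableIn.comp (hf.comp ComputableIn.snd)
  sound h := by simpa [eq_comm] using h
  complete h := .of_forall fun _ => congrArg some (Part.mem_some_iff.1 h).symm

theorem Approximates.comp {O : Set (ℕ →. ℕ)} {f h : ℕ →. ℕ} {e d : ℕ → ℕ → Option ℕ}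
    (hf : Approximates O f e) (hh : Approximates O h d) :
    Approximates O (fun n => h n >>= f) fun k n => (d k n).bind (e k) where
  computableIn := by
    -- Here `e` is evaluated even where `d` gives `none`, at a default argument; the outer bind
    -- discards that value.
    have := Primrec₂.compIn (f := fun (a b : Option ℕ) => a.bind fun _ => b)
      (Primrec.option_bind Primrec.fst (Primrec.snd.comp Primrec.fst).to₂).to₂ hh.computableIn
      (hf.computableIn.comp ComputableIn.fst
        ((Primrec.option_getD_default (α := ℕ)).computableIn.comp hh.computableIn))
    refine this.of_eq fun p => ?_
    dsimp only
    cases d p.1 p.2 <;> rfl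
  sound {k n x} H := by
    obtain ⟨y, hy, hx⟩ := Option.bind_eq_some_iff.1 H
    exact Part.mem_bind_iff.2 ⟨y, hh.sound hy, hf.sound hx⟩
  complete {n x} H := by
    obtain ⟨y, hy, hx⟩ := Part.mem_bind_iff.1 H
    filter_upwards [hh.complete hy, hf.complete hx] with k h₁ h₂
    simp [h₁, h₂]

theorem Approximates.pair {O : Set (ℕ →. ℕ)} {f h : ℕ →. ℕ} {e d : ℕ → ℕ → Option ℕ}
    (hf : Approximates O f e) (hh : Approximates O h d) :
    Approximates O (fun n => Nat.pair <$> f n <*> h n)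
      fun k n => (e k n).bind fun x => (d k n).map (Nat.pair x) where
  computableIn :=
    Primrec₂.compIn (f := fun (a b : Option ℕ) => a.bind fun x => b.map (Nat.pair x))
      (Primrec.option_bind Primrec.fst (Primrec.option_map (Primrec.snd.comp Primrec.fst)
        (Primrec₂.natPair.comp (Primrec.snd.comp Primrec.fst) Primrec.snd).to₂).to₂).to₂
      hf.computableIn hh.computableIn
  sound {k n x} H := by
    obtain ⟨y, hy, hx⟩ := Option.bind_eq_some_iff.1 H
    obtain ⟨z, hz, rfl⟩ := Option.map_eq_some_iff.1 hx
    have : ∃ y' ∈ f n, ∃ z' ∈ h n, Nat.pair y' z' = Nat.pair y z :=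
      ⟨y, hf.sound hy, z, hh.sound hz, rfl⟩
    simpa [Seq.seq, -Nat.pair_eq_pair] using this
  complete {n x} H := by
    obtain ⟨y, hy, z, hz, rfl⟩ : ∃ y ∈ f n, ∃ z ∈ h n, Nat.pair y z = x := by
      simpa [Seq.seq] using H
    filter_upwards [hf.complete hy, hh.complete hz] with k h₁ h₂
    simp [h₁, h₂]

theorem Approximates.prec {O : Set (ℕ →. ℕ)} {f h : ℕ →. ℕ} {e d : ℕ → ℕ → Option ℕ}
    (hf : Approximates O f e) (hh : Approximates O h d) :
    Approximates O
      (fun p => let (a, n) := Nat.unpair p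
        n.rec (f a) fun y IH => do
          let i ← IH
          h (Nat.pair a (Nat.pair y i)))
      fun k p => Nat.rec (motive := fun _ => Option ℕ) (e k p.unpair.1)
        (fun y IH => IH.bind fun i => d k (Nat.pair p.unpair.1 (Nat.pair y i))) p.unpair.2 where
  computableIn := by
    have hu₁ : Primrec fun p : ℕ × ℕ => p.2.unpair.1 :=
      Primrec.fst.comp (Primrec.unpair.comp Primrec.snd)
    have hi : Primrec fun q : (ℕ × ℕ) × ℕ × Option ℕ =>
        Nat.pair q.1.2.unpair.1 (Nat.pair q.2.1 (q.2.2.getD default)) :=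
      Primrec₂.natPair.comp (hu₁.comp Primrec.fst)
        (Primrec₂.natPair.comp (Primrec.fst.comp Primrec.snd)
          (Primrec.option_getD_default.comp (Primrec.snd.comp Primrec.snd)))
    refine (ComputableIn.nat_rec
      (f := fun p : ℕ × ℕ => p.2.unpair.2) (g := fun p => e p.1 p.2.unpair.1)
      (h := fun p q => q.2.bind fun _ =>
        d p.1 (Nat.pair p.2.unpair.1 (Nat.pair q.1 (q.2.getD default))))
      (Primrec.snd.comp (Primrec.unpair.comp Primrec.snd)).computableIn
      (hf.computableIn.comp ComputableIn.fst hu₁.computableIn) ?_).of_eq fun p => ?_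
    · exact Primrec₂.compIn (f := fun (a b : Option ℕ) => a.bind fun _ => b)
        (Primrec.option_bind Primrec.fst (Primrec.snd.comp Primrec.fst).to₂).to₂
        (ComputableIn.snd.comp ComputableIn.snd)
        (hh.computableIn.comp (ComputableIn.fst.comp ComputableIn.fst) hi.computableIn)
    · dsimp only
      congr 1
      funext y IH
      cases IH <;> rfl
  sound {k p x} H := by
    change x ∈ Nat.rec (motive := fun _ => Part ℕ) (f p.unpair.1)
      (fun y IH => IH >>= fun i => h (Nat.pair p.unpair.1 (Nat.pair y i))) p.unpair.2
    revert x
    induction p.unpair.2 with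
    | zero => exact fun h => hf.sound h
    | succ n ih =>
      intro x H
      obtain ⟨y, hy, hx⟩ := Option.bind_eq_some_iff.1 H
      exact Part.mem_bind_iff.2 ⟨y, ih hy, hh.sound hx⟩
  complete {p x} H := by
    change x ∈ Nat.rec (motive := fun _ => Part ℕ) (f p.unpair.1)
      (fun y IH => IH >>= fun i => h (Nat.pair p.unpair.1 (Nat.pair y i))) p.unpair.2 at H
    revert x
    induction p.unpair.2 with
    | zero => exact fun h => hf.complete h
    | succ n ih =>
      intro x H
      obtain ⟨y, hy, hx⟩ := Part.mem_bind_iff.1 H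
      filter_upwards [ih hy, hh.complete hx] with k h₁ h₂
      simp [h₁, h₂]

/-- The bounded search for the least `m` at which `u` is not a positive value. -/
def boundedSearch (u : ℕ → Option ℕ) : ℕ → ℕ
  | 0 => 0
  | j + 1 => if 0 < (u (boundedSearch u j)).getD 0 then boundedSearch u j + 1
      else boundedSearch u j

theorem pos_of_lt_boundedSearch {u : ℕ → Option ℕ} {j m : ℕ} (h : m < boundedSearch u j) :
    0 < (u m).getD 0 := by
  induction j with
  | zero => simp [boundedSearch] at h
  | succ j ih =>
    rw [boundedSearch] at h
    split_ifs at h with h'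
    · rcases Nat.lt_succ_iff_lt_or_eq.1 h with h | rfl
      · exact ih h
      · exact h'
    · exact ih h

theorem boundedSearch_eq_min {u : ℕ → Option ℕ} {x : ℕ} (hlt : ∀ m < x, 0 < (u m).getD 0)
    (hx : (u x).getD 0 = 0) (j : ℕ) : boundedSearch u j = min j x := by
  induction j with
  | zero => simp [boundedSearch]
  | succ j ih =>
    rw [boundedSearch, ih]
    rcases lt_or_ge j x with h | h
    · rw [min_eq_left h.le, if_pos (hlt j h), min_eq_left h]
    · rw [min_eq_right h, if_neg (by simp [hx]), min_eq_right (by omega)]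

/-- After `k` steps the search has reached the answer, run out of steps, or stopped where no value
is known yet. Testing for `some 0` keeps only the first case or a search that ran out exactly at the
answer. A correct answer depends on finitely many values of `f`, all known from some stage on. -/
theorem Approximates.rfind {O : Set (ℕ →. ℕ)} {f : ℕ →. ℕ} {e : ℕ → ℕ → Option ℕ}
    (hf : Approximates O f e) :
    Approximates O (fun a => Nat.rfind fun n => (fun m => m = 0) <$> f (Nat.pair a n))
      fun k a => if e k (Nat.pair a (boundedSearch (fun m => e k (Nat.pair a m)) k)) = some 0 then
        some (boundedSearch (fun m => e k (Nat.pair a m)) k) else none where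
  computableIn := by
    have hs : ComputableIn O fun p : ℕ × ℕ =>
        boundedSearch (fun m => e p.1 (Nat.pair p.2 m)) p.1 := by
      have hc : PrimrecPred fun q : ℕ × Option ℕ => 0 < q.2.getD 0 :=
        Primrec.nat_lt.comp (Primrec.const 0)
          (Primrec.option_getD.comp Primrec.snd (Primrec.const 0))
      have hstep : Primrec₂ fun (s : ℕ) (o : Option ℕ) => if 0 < o.getD 0 then s + 1 else s :=
        (Primrec.ite hc (Primrec.succ.comp Primrec.fst) Primrec.fst).to₂
      refine (ComputableIn.nat_rec (f := fun p : ℕ × ℕ => p.1) (g := fun _ => 0)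
        (h := fun p q => if 0 < (e p.1 (Nat.pair p.2 q.2)).getD 0 then q.2 + 1 else q.2)
        ComputableIn.fst (ComputableIn.const 0) ?_).of_eq fun p => ?_
      · exact Primrec₂.compIn hstep (ComputableIn.snd.comp ComputableIn.snd)
          (hf.computableIn.comp (ComputableIn.fst.comp ComputableIn.fst)
            (Primrec₂.compIn Primrec₂.natPair
              (ComputableIn.snd.comp ComputableIn.fst) (ComputableIn.snd.comp ComputableIn.snd)))
      · dsimp only
        generalize p.1 = k at *
        suffices ∀ j, Nat.rec (motive := fun _ => ℕ) 0 (fun _ IH =>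
            if 0 < (e k (Nat.pair p.2 IH)).getD 0 then IH + 1 else IH) j =
              boundedSearch (fun m => e k (Nat.pair p.2 m)) j from this k
        intro j
        induction j with
        | zero => rfl
        | succ j ih => simp only [boundedSearch, ih]
    have hout : Primrec₂ fun (s : ℕ) (o : Option ℕ) => if o = some 0 then some s else none :=
      (Primrec.ite (Primrec.eq.comp Primrec.snd (Primrec.const (some 0)))
        (Primrec.option_some.comp Primrec.fst) (Primrec.const none)).to₂
    exact Primrec₂.compIn hout hs (hf.computableIn.comp ComputableIn.fst
      (Primrec₂.compIn Primrec₂.natPair ComputableIn.snd hs))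
  sound {k a x} H := by
    obtain ⟨h₀, rfl⟩ : _ ∧ _ := by simpa using H
    refine Nat.mem_rfind.2 ⟨?_, fun {m} hm => ?_⟩
    · simpa using hf.sound h₀
    · have := pos_of_lt_boundedSearch hm
      obtain ⟨v, hv⟩ : ∃ v, e k (Nat.pair a m) = some v := by
        cases h : e k (Nat.pair a m) with
        | none => simp [h] at this
        | some v => exact ⟨v, rfl⟩
      rw [hv] at this
      have hne : v ≠ 0 := by simpa using this.ne'
      simpa using ⟨v, hf.sound hv, hne⟩
  complete {a x} H := by
    obtain ⟨h₀, hlt⟩ := Nat.mem_rfind.1 H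
    have hlt' : ∀ m ∈ Finset.range x, ∀ᶠ k in atTop, 0 < (e k (Nat.pair a m)).getD 0 := by
      intro m hm
      obtain ⟨v, hv, hne⟩ : ∃ v ∈ f (Nat.pair a m), v ≠ 0 := by
        simpa using hlt (Finset.mem_range.1 hm)
      filter_upwards [hf.complete hv] with k hk
      simpa [hk] using Nat.pos_of_ne_zero hne
    have h₀' : 0 ∈ f (Nat.pair a x) := by simpa using h₀
    filter_upwards [(Filter.eventually_all_finset _).2 hlt', hf.complete h₀',
      eventually_ge_atTop x] with k h₁ h₂ h₃
    have : boundedSearch (fun m => e k (Nat.pair a m)) k = x := by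
      rw [boundedSearch_eq_min (x := x) (fun m hm => h₁ m (Finset.mem_range.2 hm)) (by simp [h₂]),
        min_eq_right h₃]
    simp [this, h₂]

/-- Every partial function recursive in a total oracle is the limit of a computable sequence of
total functions. -/
theorem Nat.RecursiveIn.exists_approximates {a : ℕ → ℕ} {f : ℕ →. ℕ}
    (hf : Nat.RecursiveIn {(a : ℕ →. ℕ)} f) : ∃ e, Approximates {(a : ℕ →. ℕ)} f e := by
  induction hf with
  | zero => exact ⟨_, .of_total (f := fun _ => 0) (ComputableIn.const 0)⟩
  | succ => exact ⟨_, .of_total ComputableIn.succ⟩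
  | left => exact ⟨_, .of_total (ComputableIn.fst.comp ComputableIn.unpair)⟩
  | right => exact ⟨_, .of_total (ComputableIn.snd.comp ComputableIn.unpair)⟩
  | oracle g hg =>
    obtain rfl := Set.mem_singleton_iff.1 hg
    exact ⟨_, .of_total (f := a) (_root_.RecursiveIn.oracle (a : ℕ →. ℕ) hg)⟩
  | pair _ _ hf hh => exact ⟨_, hf.choose_spec.pair hh.choose_spec⟩
  | comp _ _ hf hh => exact ⟨_, hf.choose_spec.comp hh.choose_spec⟩
  | prec _ _ hf hh => exact ⟨_, hf.choose_spec.prec hh.choose_spec⟩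
  | rfind _ hf => exact ⟨_, hf.choose_spec.rfind⟩

/-- A predicate that is recursively enumerable in `A` is a projection of one computable in `A`. -/
theorem REPredInSet.exists_computableIn {β : Type*} [Primcodable β] {A : Set ℕ} {p : β → Prop}
    (hp : REPredInSet A p) :
    ∃ R : β → ℕ → Bool, ComputableIn₂ {oracleOf A} R ∧ ∀ b, p b ↔ ∃ s, R b s := by
  obtain ⟨e, he⟩ := Nat.RecursiveIn.exists_approximates (a := A.indicator fun _ => 1) hp
  refine ⟨fun b s => (e s (encode b)).isSome, ?_, fun b => ⟨fun h => ?_, ?_⟩⟩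
  · exact Primrec.option_isSome.computableIn.comp
      (he.computableIn.comp ComputableIn.snd (Primrec.encode.computableIn.comp ComputableIn.fst))
  · have := he.complete (n := encode b) (x := encode ()) (by
      simpa [Part.assert, h] using ⟨(), rfl⟩)
    obtain ⟨k, hk⟩ := this.exists
    exact ⟨k, by simp [hk]⟩
  · rintro ⟨s, hs⟩
    obtain ⟨x, hx⟩ := Option.isSome_iff_exists.1 hs
    have := he.sound hx
    simp only [encodek, Part.coe_some, Part.bind_some, Part.mem_map_iff,
      Part.mem_assert_iff] at this
    exact this.choose_spec.1.choose

theorem REPredInSet.of_exists {β γ : Type*} [Primcodable β] [Primcodable γ] [Inhabited γ]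
    {A : Set ℕ} {p : β → Prop} {R : β → γ → Bool} (hR : ComputableIn₂ {oracleOf A} R)
    (h : ∀ b, p b ↔ ∃ s, R b s) : REPredInSet A p := by
  have hd : ComputableIn {oracleOf A} fun n : ℕ => (decode (α := γ) n).getD default :=
    (Primrec.option_getD_default.comp Primrec.decode).computableIn
  have hR' : ComputableIn₂ {oracleOf A} fun b n => R b ((decode (α := γ) n).getD default) :=
    (hR.comp ComputableIn.fst (hd.comp ComputableIn.snd)).to₂
  refine ((RecursiveIn.rfind hR'.recursiveIn₂).map (g := fun _ _ => ())
    (ComputableIn.const ())).of_eq fun b => ?_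
  refine Part.ext fun u => ?_
  cases u
  simp only [Part.mem_map_iff, Part.mem_assert_iff, h b]
  constructor
  · rintro ⟨n, hn, -⟩
    exact ⟨⟨_, (Part.mem_some_iff.1 (Nat.rfind_spec hn)).symm⟩, Part.mem_some _⟩
  · rintro ⟨⟨s, hs⟩, -⟩
    obtain ⟨n, hn, -⟩ := Nat.rfind_min' (p := fun n => R b ((decode (α := γ) n).getD default))
      (m := encode s) (by simpa using hs)
    exact ⟨n, hn, trivial⟩

end Approximation

/-! ### Strings, cylinders and nowhere density. -/

section Cylinders

variable {α : Type*}

theorem mem_stringCylinder_iff_take {σ : List α} {x : ℕ → α} :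
    x ∈ stringCylinder σ ↔ (List.range σ.length).map x = σ := by
  constructor
  · intro h
    refine List.ext_getElem (by simp) fun i _ hi => ?_
    simpa using h i hi
  · intro h i hi
    have := congrArg (fun l => l[i]?) h
    simpa [hi] using this

theorem mem_stringCylinder_range_map (x : ℕ → α) (n : ℕ) :
    x ∈ stringCylinder ((List.range n).map x) := by
  intro i hi
  simp

/-- The point that extends `σ` by `x`. -/
def extendString (σ : List α) (x : ℕ → α) (i : ℕ) : α :=
  σ.getD i (x i)

theorem extendString_mem (σ : List α) (x : ℕ → α) : extendString σ x ∈ stringCylinder σ := by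
  intro i hi
  simp [extendString, hi]

theorem extendString_apply_of_le {σ : List α} {i : ℕ} (h : σ.length ≤ i) (x : ℕ → α) :
    extendString σ x i = x i := by
  simp [extendString, List.getElem?_eq_none h]

variable [TopologicalSpace α] [DiscreteTopology α]

theorem isOpen_stringCylinder (σ : List α) : IsOpen (stringCylinder σ) := by
  have : stringCylinder σ = ⋂ i : Fin σ.length, (fun x : ℕ → α => x i) ⁻¹' {σ[i]} := by
    ext x
    simp [stringCylinder, Fin.forall_iff]
  rw [this]
  exact isOpen_iInter_of_finite fun i => (isOpen_discrete _).preimage (continuous_apply _)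

theorem exists_stringCylinder_subset {U : Set (ℕ → α)} (hU : IsOpen U) {x : ℕ → α} (hx : x ∈ U) :
    ∃ σ, x ∈ stringCylinder σ ∧ stringCylinder σ ⊆ U := by
  obtain ⟨_, ⟨y, n, rfl⟩, hxy, hyU⟩ :=
    (PiNat.isTopologicalBasis_cylinders fun _ : ℕ => α).exists_subset_of_mem_open hx hU
  rw [PiNat.mem_cylinder_iff_eq] at hxy
  rw [← hxy] at hyU
  refine ⟨_, mem_stringCylinder_range_map x n, fun z hz => hyU fun i hi => ?_⟩
  have := hz i (by simpa using hi)
  rwa [List.getElem_map, List.getElem_range] at this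

/-- Since `C` is closed, it is nowhere dense iff its interior is empty; cylinders are nonempty and
form a basis. -/
theorem isNowhereDense_iff_of_compl_eq [Nonempty α] {C : Set (ℕ → α)} {V : Set (List α)}
    (hC : Cᶜ = ⋃ σ ∈ V, stringCylinder σ) :
    IsNowhereDense C ↔ ∀ σ, ∃ x ∈ stringCylinder σ, x ∉ C := by
  have hclosed : IsClosed C := by
    rw [← isOpen_compl_iff, hC]
    exact isOpen_biUnion fun σ _ => isOpen_stringCylinder σ
  rw [hclosed.isNowhereDense_iff]
  constructor
  · intro h σ
    by_contra! hσ
    have : stringCylinder σ ⊆ interior C :=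
      interior_maximal (fun x hx => hσ x hx) (isOpen_stringCylinder σ)
    rw [h] at this
    exact this (extendString_mem σ fun _ => Classical.arbitrary α)
  · intro h
    rw [Set.eq_empty_iff_forall_notMem]
    intro x hx
    obtain ⟨σ, -, hσ⟩ := exists_stringCylinder_subset isOpen_interior hx
    obtain ⟨y, hy, hyC⟩ := h σ
    exact hyC (interior_subset (hσ hy))

end Cylinders

/-! ### From an eventually disagreeing function to a meager set in Cantor space. -/

section CantorSpace

/-- The points `x` of Cantor space with `x n = ⋯ = x (n + k - 1) = 0` and `x (n + k) = 1`. -/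
def CodesAt (x : ℕ → Bool) (n k : ℕ) : Prop :=
  (∀ i < k, x (n + i) = false) ∧ x (n + k) = true

/-- The string `0 ⋯ 0 1` with `k` zeros. -/
def zerosOne (k : ℕ) : List Bool :=
  (List.range k).map (fun _ => false) ++ [true]

theorem primrec_zerosOne : Primrec zerosOne :=
  Primrec.list_append.comp (Primrec.list_map Primrec.list_range (Primrec.const false).to₂)
    (Primrec.const [true])

/-- Presents the condition as an open set given by a decidable set of strings, as needed for the
complement of a `Π⁰₁` class. -/
theorem codesAt_iff_exists {x : ℕ → Bool} {n k : ℕ} :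
    CodesAt x n k ↔ ∃ σ : List Bool, σ.drop n = zerosOne k ∧ x ∈ stringCylinder σ := by
  have key : ∀ N, (List.range (n + N)).drop n = (List.range N).map (n + ·) := fun N => by
    rw [List.range_add, List.drop_left' (by simp)]
  constructor
  · intro h
    refine ⟨_, ?_, mem_stringCylinder_range_map x (n + (k + 1))⟩
    rw [← List.map_drop, key, List.range_succ, zerosOne]
    simpa [h.2, List.eq_replicate_iff] using h.1
  · rintro ⟨σ, hσ, hx⟩
    have hlen := congrArg List.length hσ
    simp only [List.length_drop, zerosOne, List.length_append, List.length_map, List.length_range,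
      List.length_singleton] at hlen
    -- The truncated subtraction in `hlen` is exact because `k + 1` is positive.
    have hl : σ.length = n + (k + 1) := by omega
    rw [← mem_stringCylinder_iff_take.1 hx, ← List.map_drop, hl, key, List.range_succ,
      zerosOne] at hσ
    simpa [CodesAt, List.eq_replicate_iff] using hσ

/-- If ones recur forever, `CodesAt x n k` says exactly that `k` is the distance from `n` to the
next one, a computable function of `n`. If not, no block can end in a one beyond the last one of
`x`. -/
theorem Computable.exists_notMem_codesAt {f : ℕ → ℕ}
    (hf : ∀ g : ℕ → ℕ, Computable g → EventuallyDisagree f g) {x : ℕ → Bool} (hx : Computable x) :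
    ∃ m, ∀ n ≥ m, ¬ CodesAt x n (f n) := by
  by_cases h : ∀ n, ∃ k, x (n + k) = true
  · obtain ⟨g, hg, hxg⟩ := ComputableIn.exists_find (O := ∅) (p := fun n k => x (n + k))
      (hx.comp (Primrec.nat_add.comp Primrec.fst Primrec.snd).to_comp).computableIn h
    obtain ⟨m, hm⟩ := Filter.eventually_atTop.1 (hf g (recursiveIn_empty_iff.1 hg))
    refine ⟨m, fun n hn hc => hm n hn ?_⟩
    rcases lt_trichotomy (f n) (g n) with hlt | heq | hlt
    · exact absurd hc.2 ((hxg n).2 _ hlt)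
    · exact heq
    · exact absurd (hxg n).1 (by simp [hc.1 _ hlt])
  · push Not at h
    obtain ⟨m, hm⟩ := h
    refine ⟨m, fun n hn hc => hm (n - m + f n) ?_⟩
    rw [← hc.2]
    congr 1
    omega

theorem ComputesEventuallyDisagreeing.weaklyMeagerEngulfing_bool {A : Set ℕ}
    (h : ComputesEventuallyDisagreeing A) : WeaklyMeagerEngulfing Bool A := by
  obtain ⟨f, hfA, hf⟩ := h
  let C : ℕ → Set (ℕ → Bool) := fun m => {x | ∀ n ≥ m, ¬ CodesAt x n (f n)}
  let W : ℕ × List Bool → Prop := fun p => ∃ n, p.1 ≤ n ∧ p.2.drop n = zerosOne (f n)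
  have hC : ∀ m, (C m)ᶜ = ⋃ σ ∈ {σ : List Bool | W (m, σ)}, stringCylinder σ := by
    intro m
    ext x
    simp only [C, W, Set.mem_compl_iff, Set.mem_ofPred_eq, Set.mem_iUnion, not_forall, not_not,
      codesAt_iff_exists]
    constructor
    · rintro ⟨n, hn, σ, hσ, hx⟩
      exact ⟨σ, ⟨n, hn, hσ⟩, hx⟩
    · rintro ⟨σ, ⟨n, hn, hσ⟩, hx⟩
      exact ⟨n, hn, σ, hσ, hx⟩
  refine ⟨⋃ m, C m, ⟨C, ⟨W, ?_, hC⟩, fun m => ?_, subset_rfl⟩, fun x hx => ?_⟩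
  · refine REPredInSet.of_exists (γ := ℕ)
      (R := fun p n => decide (p.1 ≤ n) && decide (p.2.drop n = zerosOne (f n))) ?_
      fun p => by simp [W]
    have h₁ : Primrec fun p : (ℕ × List Bool) × ℕ => decide (p.1.1 ≤ p.2) :=
      (Primrec.nat_le.comp (Primrec.fst.comp Primrec.fst) Primrec.snd).decide
    have h₂ : Primrec₂ fun l k => decide (l = zerosOne k) :=
      (Primrec.eq.comp Primrec.fst (primrec_zerosOne.comp Primrec.snd)).decide
    have h₃ : Primrec fun p : (ℕ × List Bool) × ℕ => p.1.2.drop p.2 :=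
      Primrec.list_drop.comp Primrec.snd (Primrec.snd.comp Primrec.fst)
    exact Primrec.and.compIn h₁.computableIn
      (h₂.compIn h₃.computableIn (ComputableIn.comp (f := f) hfA ComputableIn.snd))
  · refine (isNowhereDense_iff_of_compl_eq (hC m)).2 fun σ => ?_
    -- With `N = max m σ.length`, the string is continued by zeros and a single one at position `N +
    -- f N`.
    refine ⟨_, extendString_mem σ fun i =>
      decide (i = max m σ.length + f (max m σ.length)), fun hx => ?_⟩
    refine hx (max m σ.length) (le_max_left _ _) ⟨fun i hi => ?_, ?_⟩
    · rw [extendString_apply_of_le (by omega)]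
      simpa using hi.ne
    · rw [extendString_apply_of_le (by omega)]
      simp
  · obtain ⟨m, hm⟩ := hx.exists_notMem_codesAt hf
    exact Set.mem_iUnion.2 ⟨m, hm⟩

end CantorSpace

/-! ### Transfer from Cantor space to Baire space by parity. -/

section BaireSpace

theorem WeaklyMeagerEngulfing.nat_of_bool {A : Set ℕ} (h : WeaklyMeagerEngulfing Bool A) :
    WeaklyMeagerEngulfing ℕ A := by
  obtain ⟨S, ⟨C, ⟨W, hW, hC⟩, hnd, hS⟩, hx⟩ := h
  have hcyl : ∀ (x : ℕ → ℕ) (τ : List ℕ), x ∈ stringCylinder τ →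
      (fun i => (x i).bodd) ∈ stringCylinder (τ.map Nat.bodd) := by
    intro x τ hx i hi
    simp [hx i (by simpa using hi)]
  have hC' : ∀ m, ((fun (x : ℕ → ℕ) i => (x i).bodd) ⁻¹' C m)ᶜ =
      ⋃ τ ∈ {τ : List ℕ | W (m, τ.map Nat.bodd)}, stringCylinder τ := by
    intro m
    rw [← Set.preimage_compl, hC m]
    ext x
    simp only [Set.mem_preimage, Set.mem_iUnion, Set.mem_ofPred_eq, exists_prop]
    constructor
    · rintro ⟨σ, hσ, hx⟩
      refine ⟨(List.range σ.length).map x, ?_, mem_stringCylinder_range_map x _⟩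
      rw [mem_stringCylinder_iff_take] at hx
      rw [List.map_map]
      exact hx.symm ▸ hσ
    · rintro ⟨τ, hτ, hx⟩
      exact ⟨_, hτ, hcyl x τ hx⟩
  refine ⟨_, ⟨_, ⟨fun p => W (p.1, p.2.map Nat.bodd), ?_, hC'⟩, fun m => ?_, subset_rfl⟩,
    fun x hcx => ?_⟩
  · exact RecursiveIn.comp hW (Primrec.fst.pair (Primrec.list_map Primrec.snd
      (Primrec.nat_bodd.comp Primrec.snd).to₂)).computableIn
  · refine (isNowhereDense_iff_of_compl_eq (hC' m)).2 fun τ => ?_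
    obtain ⟨y, hy, hyC⟩ :=
      (isNowhereDense_iff_of_compl_eq (hC m)).1 (hnd m) (τ.map Nat.bodd)
    -- Continuing `τ` by the bits of `y`, read as numbers, gives a point whose parities are exactly
    -- `y`.
    refine ⟨_, extendString_mem τ fun i => (y i).toNat, fun hmem => hyC ?_⟩
    convert Set.mem_preimage.1 hmem using 1
    funext i
    rcases lt_or_ge i τ.length with h | h
    · rw [extendString_mem τ _ i h, hy i (by simpa using h)]
      simp
    · rw [extendString_apply_of_le h]
      cases y i <;> rfl
  · have := hS (hx _ (Computable.nat_bodd.comp hcx))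
    simpa using this

end BaireSpace

/-! ### Computable guesses that are right infinitely often. -/

section InfinitelyOftenEqual

open Encodable Filter

theorem ComputableIn.exists_monotone_bound {O : Set (ℕ →. ℕ)} {t : ℕ → ℕ}
    (ht : ComputableIn O t) : ∃ S : ℕ → ℕ, ComputableIn O S ∧ Monotone S ∧ ∀ n, t n ≤ S n := by
  refine ⟨fun n => Nat.rec (motive := fun _ => ℕ) (t 0) (fun y IH => max IH (t (y + 1))) n,
    ?_, monotone_nat_of_le_succ fun n => le_max_left _ _, fun n => ?_⟩
  · exact ComputableIn.nat_rec (h := fun _ q => max q.2 (t (q.1 + 1))) ComputableIn.id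
      (ComputableIn.const _) (Primrec.nat_max.compIn (ComputableIn.snd.comp ComputableIn.snd)
        (ht.comp (Primrec.succ.compIn (ComputableIn.fst.comp ComputableIn.snd))))
  · cases n
    · exact le_rfl
    · exact le_max_right _ _

theorem ComputableIn.exists_strictMono_enumeration {O : Set (ℕ →. ℕ)} {R : ℕ → Bool}
    (hR : ComputableIn O R) (hfreq : ∃ᶠ k in atTop, R k) :
    ∃ c : ℕ → ℕ, ComputableIn O c ∧ StrictMono c ∧ ∀ j, R (c j) := by
  obtain ⟨next, hnext, hspec⟩ := ComputableIn.exists_choice (O := O)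
    (p := fun n k : ℕ => decide (n ≤ k) && R k)
    (Primrec.and.compIn (Primrec.nat_le.decide.compIn ComputableIn.fst ComputableIn.snd)
      (hR.comp ComputableIn.snd)) fun n => by
        obtain ⟨k, hk, hRk⟩ := frequently_atTop.1 hfreq n
        exact ⟨k, by simp [hk, hRk]⟩
  simp only [Bool.and_eq_true, decide_eq_true_eq] at hspec
  refine ⟨fun n => Nat.rec (motive := fun _ => ℕ) (next 0) (fun _ IH => next (IH + 1)) n, ?_,
    strictMono_nat_of_lt_succ fun n => (hspec _).1, fun j => ?_⟩
  · exact ComputableIn.nat_rec (h := fun _ q => next (q.2 + 1)) ComputableIn.id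
      (ComputableIn.const _)
        (hnext.comp (Primrec.succ.compIn (ComputableIn.snd.comp ComputableIn.snd)))
  · cases j <;> exact (hspec _).2

variable {A : Set ℕ} {γ : Type*}

/-- The hypothesis is applied to the codes of the values of `F`. The result is optional because a
guessed number need not be a code. -/
theorem exists_guess [Primcodable γ] (H : ¬ ComputesEventuallyDisagreeing A) {F : ℕ → γ}
    (hF : ComputableIn {oracleOf A} F) :
    ∃ G : ℕ → Option γ, Computable G ∧ ∃ᶠ n in atTop, G n = some (F n) := by
  have : ¬ ∀ g : ℕ → ℕ, Computable g → EventuallyDisagree (fun n => encode (F n)) g :=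
    fun h => H ⟨_, Primrec.encode.compIn hF, h⟩
  push Not at this
  obtain ⟨g, hg, hfg⟩ := this
  refine ⟨fun n => decode (g n), Computable.decode.comp hg, (not_eventually.1 hfg).mono ?_⟩
  intro n hn
  change decode (g n) = some (F n)
  rw [← not_not.1 hn, encodek]

/-- Guessing the double iterate `h (h n)` leaves room for not knowing where the guess is right. If
it is right at `n` with `ν k ≤ n < ν (k + 1)`, then `h (h (ν k)) ≤ ν (k + 2)`. So either `h (ν k) ≤
ν (k + 1)`, or `ν (k + 1) < h (ν k)` and monotonicity gives `h (ν (k + 1)) ≤ ν (k + 2)`. -/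
theorem exists_sparse (H : ¬ ComputesEventuallyDisagreeing A) {h : ℕ → ℕ}
    (hh : ComputableIn {oracleOf A} h) (hmono : Monotone h) :
    ∃ ν : ℕ → ℕ, Computable ν ∧ StrictMono ν ∧ ν 0 = 0 ∧
      ∃ᶠ k in atTop, h (ν k) ≤ ν (k + 1) := by
  obtain ⟨G, hG, hfreq⟩ := exists_guess H (hh.comp hh)
  obtain ⟨S, hS, hSmono, hGS⟩ := ComputableIn.exists_monotone_bound (O := ∅)
    (Primrec.option_getD_default.compIn hG.computableIn)
  let ν : ℕ → ℕ := fun k => Nat.rec (motive := fun _ => ℕ) 0 (fun _ IH => IH + 1 + S IH) k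
  have hsucc : ∀ k, ν (k + 1) = ν k + 1 + S (ν k) := fun _ => rfl
  have hν : StrictMono ν := strictMono_nat_of_lt_succ fun k => by rw [hsucc]; omega
  refine ⟨ν, ?_, hν, rfl, ?_⟩
  · refine recursiveIn_empty_iff.1 (ComputableIn.nat_rec (O := ∅)
      (h := fun _ q => q.2 + 1 + S q.2) ComputableIn.id (ComputableIn.const 0) ?_)
    have hq : ComputableIn ∅ fun q : ℕ × ℕ × ℕ => q.2.2 := ComputableIn.snd.comp ComputableIn.snd
    exact Primrec.nat_add.compIn (Primrec.succ.compIn hq) (hS.comp hq)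
  · refine frequently_atTop.2 fun N => ?_
    obtain ⟨n, hn, hGn⟩ := frequently_atTop.1 hfreq (ν N)
    have hex : ∃ k, n < ν (k + 1) := ⟨n, Nat.lt_of_lt_of_le n.lt_succ_self (hν.id_le _)⟩
    obtain ⟨k, hk, hmin⟩ : ∃ k, n < ν (k + 1) ∧ ∀ j < k, ν (j + 1) ≤ n :=
      ⟨Nat.find hex, Nat.find_spec hex, fun j hj => not_lt.1 (Nat.find_min hex hj)⟩
    have hνk : ν k ≤ n := by
      cases k with
      | zero => exact Nat.zero_le n
      | succ j => exact hmin j j.lt_succ_self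
    have hNk : N ≤ k := by
      have : N < k + 1 := hν.lt_iff_lt.1 (lt_of_le_of_lt hn hk)
      omega
    have hbound : h (h (ν k)) ≤ ν (k + 1 + 1) := by
      have h₁ : h (h n) ≤ S n := by simpa [hGn] using hGS n
      have h₂ := hSmono hk.le
      have h₃ := hmono (hmono hνk)
      rw [hsucc (k + 1)]
      omega
    rcases le_or_gt (h (ν k)) (ν (k + 1)) with hle | hlt
    · exact ⟨k, hNk, hle⟩
    · exact ⟨k + 1, by omega, (hmono hlt.le).trans hbound⟩

/-- Append to the association list `Z` the first pair of `L` with a new key that is at least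
`n`. -/
def appendNewKey (n : ℕ) (Z L : List (ℕ × γ)) : List (ℕ × γ) :=
  Z ++ ((L.filter fun a => n ≤ a.1 ∧ (Z.lookup a.1).isSome = false).head?).toList

theorem primrec_appendNewKey [Primcodable γ] :
    Primrec fun q : (ℕ × List (ℕ × γ)) × List (ℕ × γ) => appendNewKey q.1.1 q.1.2 q.2 := by
  have hrel : PrimrecRel fun (a : ℕ × γ) (b : ℕ × List (ℕ × γ)) =>
      b.1 ≤ a.1 ∧ (b.2.lookup a.1).isSome = false :=
    (Primrec.nat_le.comp (Primrec.fst.comp Primrec.snd) (Primrec.fst.comp Primrec.fst)).and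
      (Primrec.eq.comp (Primrec.option_isSome.comp (Primrec.listLookup.comp
        (Primrec.fst.comp Primrec.fst) (Primrec.snd.comp Primrec.snd))) (Primrec.const false))
  exact Primrec.list_append.comp (Primrec.snd.comp Primrec.fst)
    (Primrec.optionToList.comp (Primrec.list_head?.comp
      (hrel.listFilter.comp Primrec.snd Primrec.fst)))

theorem lookup_appendNewKey_of_eq_some {n k : ℕ} {Z L : List (ℕ × γ)} {v : γ}
    (h : Z.lookup k = some v) : (appendNewKey n Z L).lookup k = some v := by
  simp [appendNewKey, List.lookup_append, h]

theorem length_appendNewKey_le (n : ℕ) (Z L : List (ℕ × γ)) :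
    (appendNewKey n Z L).length ≤ Z.length + 1 := by
  rw [appendNewKey, List.length_append]
  cases (L.filter fun a => n ≤ a.1 ∧ (Z.lookup a.1).isSome = false).head? <;> simp

theorem exists_lookup_appendNewKey {n : ℕ} {Z L : List (ℕ × γ)}
    (h : ∃ a ∈ L, n ≤ a.1 ∧ (Z.lookup a.1).isSome = false) :
    ∃ a ∈ L, n ≤ a.1 ∧ (appendNewKey n Z L).lookup a.1 = some a.2 := by
  obtain ⟨b, hbL, hb⟩ := h
  obtain ⟨a, ha⟩ : ∃ a, (L.filter fun a => n ≤ a.1 ∧ (Z.lookup a.1).isSome = false).head? =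
      some a := by
    rw [← Option.isSome_iff_exists, List.isSome_head?]
    exact List.ne_nil_of_mem (List.mem_filter.2 ⟨hbL, by simpa using hb⟩)
  have hmem := List.mem_filter.1 (List.mem_of_head? ha)
  have hcond : n ≤ a.1 ∧ (Z.lookup a.1).isSome = false := by simpa using hmem.2
  have hnone : Z.lookup a.1 = none := by simpa using hcond.2
  refine ⟨a, hmem.1, hcond.1, ?_⟩
  rw [appendNewKey, ha, List.lookup_append, hnone]
  simp [List.lookup]

/-- Pigeonhole: `n + 1` distinct keys do not fit among at most `n` entries. -/
theorem exists_lookup_isSome_eq_false {Z : List (ℕ × γ)} {n : ℕ} (hZ : Z.length ≤ n) {c : ℕ → ℕ}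
    (hc : Function.Injective c) : ∃ j < n + 1, (Z.lookup (c j)).isSome = false := by
  by_contra! hcon
  have hsub : (Finset.range (n + 1)).image c ⊆ (Z.map Prod.fst).toFinset := by
    intro k hk
    obtain ⟨j, hj, rfl⟩ := Finset.mem_image.1 hk
    have := hcon j (Finset.mem_range.1 hj)
    obtain ⟨v, hv⟩ := Option.isSome_iff_exists.1 (Bool.eq_true_of_not_eq_false this)
    obtain ⟨l₁, l₂, rfl, -⟩ := List.lookup_eq_some_iff.1 hv
    simp
  have h₁ := Finset.card_le_card hsub
  rw [Finset.card_image_of_injective _ hc, Finset.card_range] at h₁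
  have h₂ := List.toFinset_card_le (Z.map Prod.fst)
  rw [List.length_map] at h₂
  omega

/-- A plain guess might be right only outside `R`. So at `n` a block of `n + 1` values of `F`, at
places of `R` beyond `n`, is guessed. The list `Z n` has at most `n` entries, so a correct block
always offers a new key, and whichever pair is then added is correct. -/
theorem exists_guess_on [Primcodable γ] (H : ¬ ComputesEventuallyDisagreeing A) {R : ℕ → Bool}
    (hR : ComputableIn {oracleOf A} R) (hfreq : ∃ᶠ k in atTop, R k) {F : ℕ → γ}
    (hF : ComputableIn {oracleOf A} F) :
    ∃ g : ℕ → Option γ, Computable g ∧ ∃ᶠ k in atTop, R k ∧ g k = some (F k) := by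
  obtain ⟨c, hc, hcmono, hRc⟩ := hR.exists_strictMono_enumeration hfreq
  have hblock : ComputableIn {oracleOf A} fun n => (List.range (n + 1)).map fun j =>
      (c (n + j), F (c (n + j))) := by
    have hcn : ComputableIn {oracleOf A} fun p : ℕ × ℕ => c (p.1 + p.2) :=
      hc.comp (Primrec.nat_add.computableIn₂.comp ComputableIn.fst ComputableIn.snd)
    exact ComputableIn.list_range_map (g := fun n j => (c (n + j), F (c (n + j))))
      ComputableIn.succ (hcn.pair (hF.comp hcn))
  obtain ⟨G, hG, hGfreq⟩ := exists_guess H hblock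
  let Z : ℕ → List (ℕ × γ) := fun n => Nat.rec (motive := fun _ => List (ℕ × γ)) []
    (fun y IH => appendNewKey y IH ((G y).getD [])) n
  have hsucc : ∀ n, Z (n + 1) = appendNewKey n (Z n) ((G n).getD []) := fun _ => rfl
  have hZ : Computable Z := by
    have hq : Computable fun q : ℕ × ℕ × List (ℕ × γ) => q.2 := Computable.snd
    have hGq : Computable fun q : ℕ × ℕ × List (ℕ × γ) => (G q.2.1).getD [] :=
      Computable.option_getD (hG.comp (Computable.fst.comp hq)) (Computable.const [])
    have hstep : Computable fun q : ℕ × ℕ × List (ℕ × γ) =>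
        appendNewKey q.2.1 q.2.2 ((G q.2.1).getD []) := by
      have := primrec_appendNewKey.to_comp.comp (hq.pair hGq)
      exact this
    exact Computable.nat_rec (f := fun n : ℕ => n) (g := fun _ => ([] : List (ℕ × γ)))
      (h := fun _ q => appendNewKey q.1 q.2 ((G q.1).getD []))
      Computable.id (Computable.const []) hstep
  have hlen : ∀ n, (Z n).length ≤ n := fun n => by
    induction n with
    | zero => exact le_rfl
    | succ n ih =>
      rw [hsucc]
      exact (length_appendNewKey_le _ _ _).trans (by omega)
  have hpersist : ∀ {k v m n}, m ≤ n → (Z m).lookup k = some v → (Z n).lookup k = some v := by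
    intro k v m n hmn hm
    induction hmn with
    | refl => exact hm
    | step _ ih => exact lookup_appendNewKey_of_eq_some ih
  -- An entry added at stage `n` has key at least `n`, so key `k` can be read off once stage `k` is
  -- done.
  refine ⟨fun k => (Z (k + 1)).lookup k,
    Primrec.listLookup.to_comp.comp Computable.id (hZ.comp Computable.succ),
    frequently_atTop.2 fun N => ?_⟩
  obtain ⟨n, hn, hGn⟩ := frequently_atTop.1 hGfreq N
  obtain ⟨j, hj, hjZ⟩ := exists_lookup_isSome_eq_false (hlen n)
    (c := fun j => c (n + j)) (hcmono.injective.comp (add_right_injective n))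
  obtain ⟨a, haL, hna, ha⟩ := exists_lookup_appendNewKey (n := n) (Z := Z n)
    (L := (G n).getD []) ⟨(c (n + j), F (c (n + j))), by
      rw [hGn]
      exact List.mem_map.2 ⟨j, List.mem_range.2 hj, rfl⟩,
      (Nat.le_add_right n j).trans (hcmono.id_le _), hjZ⟩
  rw [hGn] at haL
  obtain ⟨i, -, rfl⟩ := List.mem_map.1 haL
  exact ⟨c (n + i), hn.trans hna, hRc _, hpersist (Nat.succ_le_succ hna) ha⟩

end InfinitelyOftenEqual

/-! ### A computable point that escapes the meager set. -/

section GenericPoint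

open Encodable Filter

variable {A : Set ℕ}

/-- Where `h (ν k) ≤ ν (k + 1)`, this bound ensures that a correctly proposed extension passes the
size test of `extendByTable`. -/
theorem exists_strings_bound {E : ℕ → List ℕ → List ℕ} (hE : ComputableIn₂ {oracleOf A} E) :
    ∃ h : ℕ → ℕ, ComputableIn {oracleOf A} h ∧ Monotone h ∧
      ∀ n, ∀ k ≤ n, ∀ σ : List ℕ, encode σ ≤ n → encode (σ ++ E k σ) ≤ h n := by
  have hdec : Primrec fun p : ℕ => Denumerable.ofNat (List ℕ) p.unpair.2 :=
    (Primrec.ofNat _).comp (Primrec.snd.comp Primrec.unpair)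
  obtain ⟨S, hS, hmono, hbd⟩ := ComputableIn.exists_monotone_bound (O := {oracleOf A})
    (Primrec.encode.compIn (Primrec.list_append.compIn hdec.computableIn
      (hE.comp (Primrec.fst.comp Primrec.unpair).computableIn hdec.computableIn)))
  have hpair : ∀ {a b n : ℕ}, a ≤ n → b ≤ n → Nat.pair a b ≤ Nat.pair n n := fun ha hb =>
    ((StrictMono.monotone fun _ _ h => Nat.pair_lt_pair_left _ h) ha).trans
      ((StrictMono.monotone fun _ _ h => Nat.pair_lt_pair_right _ h) hb)
  refine ⟨fun n => S (Nat.pair n n),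
    hS.comp (Primrec₂.natPair.compIn ComputableIn.id ComputableIn.id),
    fun m n h => hmono (hpair h h), fun n k hk σ hσ => ?_⟩
  have := (hbd (Nat.pair k (encode σ))).trans (hmono (hpair hk hσ))
  simpa using this

theorem exists_computable_of_prefix_chain {p : ℕ → List ℕ} (hp : Computable p)
    (hpre : ∀ k, p k <+: p (k + 1)) (hlen : ∀ N, ∃ k, N < (p k).length) :
    ∃ x : ℕ → ℕ, Computable x ∧ ∀ k, x ∈ stringCylinder (p k) := by
  obtain ⟨κ, hκ, hspec⟩ := ComputableIn.exists_choice (O := ∅)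
    (p := fun i k => decide (i < (p k).length))
    (Primrec.nat_lt.decide.compIn ComputableIn.fst
      (Primrec.list_length.compIn (hp.computableIn.comp ComputableIn.snd)))
    fun N => by simpa using hlen N
  simp only [decide_eq_true_eq] at hspec
  have hmono : ∀ {k l}, k ≤ l → p k <+: p l := by
    intro k l hkl
    induction hkl with
    | refl => exact List.prefix_rfl
    | step _ ih => exact ih.trans (hpre _)
  refine ⟨fun i => (p (κ i)).getD i 0, ?_, fun k i hi => ?_⟩
  · exact (Primrec.list_getD 0).to_comp.comp (hp.comp (recursiveIn_empty_iff.1 hκ)) Computable.id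
  · dsimp only
    rw [List.getD_eq_getElem _ _ (hspec i)]
    rcases le_total k (κ i) with h | h
    · exact ((hmono h).getElem hi).symm
    · exact (hmono h).getElem (hspec i)

/-- Extend the string `p` as the table `T` proposes, unless the code of the result exceeds `b`. -/
def extendByTable (p : List ℕ) (T : List (List ℕ)) (b : ℕ) : List ℕ :=
  if encode (p ++ T.getD (encode p) []) ≤ b then p ++ T.getD (encode p) [] else p

theorem primrec_extendByTable :
    Primrec fun q : List ℕ × List (List ℕ) × ℕ => extendByTable q.1 q.2.1 q.2.2 := by
  have h : Primrec fun q : List ℕ × List (List ℕ) × ℕ => q.1 ++ q.2.1.getD (encode q.1) [] :=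
    Primrec.list_append.comp Primrec.fst ((Primrec.list_getD []).comp
      (Primrec.fst.comp Primrec.snd) (Primrec.encode.comp Primrec.fst))
  exact Primrec.ite (Primrec.nat_le.comp (Primrec.encode.comp h) (Primrec.snd.comp Primrec.snd))
    h Primrec.fst

theorem prefix_extendByTable (p : List ℕ) (T : List (List ℕ)) (b : ℕ) :
    p <+: extendByTable p T b := by
  unfold extendByTable
  split_ifs
  · exact List.prefix_append _ _
  · exact List.prefix_rfl

theorem encode_extendByTable_le {p : List ℕ} {T : List (List ℕ)} {b : ℕ} (h : encode p ≤ b) :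
    encode (extendByTable p T b) ≤ b := by
  unfold extendByTable
  split_ifs with h'
  · exact h'
  · exact h

/-- If no `A`-computable function eventually disagrees with all computable functions, then some
computable point meets infinitely many of the open sets given by a sequence of `A`-computable
extension operators. -/
theorem exists_computable_meeting (H : ¬ ComputesEventuallyDisagreeing A)
    {E : ℕ → List ℕ → List ℕ} (hE : ComputableIn₂ {oracleOf A} E) (hne : ∀ k σ, E k σ ≠ []) :
    ∃ x : ℕ → ℕ, Computable x ∧
      ∃ᶠ k in atTop, ∃ σ, x ∈ stringCylinder (σ ++ E k σ) := by
  obtain ⟨h, hh, hmono, hbd⟩ := exists_strings_bound hE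
  obtain ⟨ν, hν, hνmono, hν₀, hfreq⟩ := exists_sparse H hh hmono
  have hνA : ComputableIn {oracleOf A} ν := hν.computableIn
  -- The code of the `k`-th string will be at most `ν k`, so this finite table of `E k` suffices at
  -- stage `k` and can be guessed as a single value.
  have htable : ComputableIn {oracleOf A} fun k => (List.range (ν k + 1)).map fun i =>
      E k (Denumerable.ofNat (List ℕ) i) :=
    ComputableIn.list_range_map (g := fun k i => E k (Denumerable.ofNat (List ℕ) i))
      (Primrec.succ.compIn hνA)
      (hE.comp ComputableIn.fst ((Primrec.ofNat _).compIn ComputableIn.snd))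
  obtain ⟨g, hg, hgfreq⟩ := exists_guess_on H
    (R := fun k => decide (h (ν k) ≤ ν (k + 1)))
    (Primrec.nat_le.decide.compIn (hh.comp hνA) (hνA.comp ComputableIn.succ))
    (by simpa using hfreq) htable
  let p : ℕ → List ℕ := fun k => Nat.rec (motive := fun _ => List ℕ) []
    (fun y IH => extendByTable IH ((g y).getD []) (ν (y + 1))) k
  have hsucc : ∀ k, p (k + 1) = extendByTable (p k) ((g k).getD []) (ν (k + 1)) := fun _ => rfl
  have hp : Computable p := by
    have hq : Computable fun q : ℕ × ℕ × List ℕ => q.2.1 := Computable.fst.comp Computable.snd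
    have hgq : Computable fun q : ℕ × ℕ × List ℕ => (g q.2.1).getD [] :=
      Computable.option_getD (hg.comp hq) (Computable.const [])
    have hstep : Computable fun q : ℕ × ℕ × List ℕ =>
        extendByTable q.2.2 ((g q.2.1).getD []) (ν (q.2.1 + 1)) := by
      have hs : Computable fun q : ℕ × ℕ × List ℕ => q.2.2 := Computable.snd.comp Computable.snd
      have := primrec_extendByTable.to_comp.comp
        (hs.pair (hgq.pair (hν.comp (Computable.succ.comp hq))))
      exact this
    exact Computable.nat_rec (f := fun n : ℕ => n) (g := fun _ => ([] : List ℕ))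
      (h := fun _ q => extendByTable q.2 ((g q.1).getD []) (ν (q.1 + 1)))
      Computable.id (Computable.const []) hstep
  have hpre : ∀ k, p k <+: p (k + 1) := fun k => prefix_extendByTable _ _ _
  have henc : ∀ k, encode (p k) ≤ ν k := fun k => by
    induction k with
    | zero => exact Nat.zero_le _
    | succ k ih => exact encode_extendByTable_le (ih.trans (hνmono k.lt_succ_self).le)
  -- At these stages the guessed table is right and `ν (k + 1)` leaves enough room, so the true
  -- extension is made.
  have hgood : ∃ᶠ k in atTop, p (k + 1) = p k ++ E k (p k) := by
    refine hgfreq.mono fun k ⟨hk, hgk⟩ => ?_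
    have hT : ((g k).getD []).getD (encode (p k)) [] = E k (p k) := by
      rw [hgk, Option.getD_some,
        List.getD_eq_getElem _ _ (by simpa using Nat.lt_succ_of_le (henc k))]
      simp
    rw [hsucc, extendByTable, hT, if_pos]
    exact (hbd (ν k) k (hνmono.id_le k) _ (henc k)).trans (by simpa using hk)
  have hlen : ∀ N, ∃ k, N < (p k).length := by
    have hstep : ∀ k, ∃ l, (p k).length < (p l).length := by
      intro k
      obtain ⟨l, hl, heq⟩ := frequently_atTop.1 hgood k
      refine ⟨l + 1, ?_⟩
      have h₁ : (p k).length ≤ (p l).length :=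
        monotone_nat_of_le_succ (f := fun k => (p k).length) (fun k => (hpre k).length_le) hl
      have h₂ := List.length_pos_of_ne_nil (hne l (p l))
      rw [heq, List.length_append]
      omega
    intro N
    induction N with
    | zero => exact (hstep 0).imp fun l hl => (Nat.zero_le _).trans_lt hl
    | succ N ih =>
      obtain ⟨k, hk⟩ := ih
      exact (hstep k).imp fun l hl => by omega
  obtain ⟨x, hx, hxp⟩ := exists_computable_of_prefix_chain hp hpre hlen
  exact ⟨x, hx, hgood.mono fun k hk => ⟨p k, hk ▸ hxp (k + 1)⟩⟩

theorem stringCylinder_subset_of_prefix {α : Type*} {σ τ : List α} (h : σ <+: τ) :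
    stringCylinder τ ⊆ stringCylinder σ := by
  intro x hx i hi
  rw [hx i (hi.trans_le h.length_le), h.getElem hi]

/-- For a sequence of dense open sets that is uniformly `Σ⁰₁` in `A`, there are `A`-computable
extension operators into the finite intersections. -/
theorem exists_extension_operators {W : ℕ × List ℕ → Prop} (hW : REPredInSet A W)
    (hdense : ∀ m σ, ∃ x ∈ stringCylinder σ, ∃ ρ, W (m, ρ) ∧ x ∈ stringCylinder ρ) :
    ∃ E : ℕ → List ℕ → List ℕ, ComputableIn₂ {oracleOf A} E ∧ (∀ k σ, E k σ ≠ []) ∧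
      ∀ k σ, ∀ m ≤ k, ∃ ρ, W (m, ρ) ∧ ρ <+: σ ++ E k σ := by
  obtain ⟨R, hR, hWR⟩ := hW.exists_computableIn
  -- A search triple holds an extension of `σ`, the length of the prefix that lies in `W`, and a
  -- stage that confirms it. That prefix may be shorter than `σ`.
  have hex : ∀ q : ℕ × List ℕ, ∃ t : List ℕ × ℕ × ℕ,
      R (q.1, (q.2 ++ t.1).take t.2.1) t.2.2 := by
    rintro ⟨m, σ⟩
    obtain ⟨x, hxσ, ρ, hρ, hxρ⟩ := hdense m σ
    obtain ⟨s, hs⟩ := (hWR _).1 hρ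
    rw [mem_stringCylinder_iff_take] at hxσ hxρ
    refine ⟨⟨(List.range ρ.length).map fun i => x (σ.length + i), ρ.length, s⟩, ?_⟩
    have hσ : σ ++ (List.range ρ.length).map (fun i => x (σ.length + i)) =
        (List.range (σ.length + ρ.length)).map x := by
      rw [List.range_add, List.map_append, List.map_map, hxσ]
      rfl
    have hρ' : ((List.range (σ.length + ρ.length)).map x).take ρ.length = ρ := by
      rw [← List.map_take, List.take_range, min_eq_left (by omega), hxρ]
    dsimp only
    rwa [hσ, hρ']
  have harg : Primrec fun q : (ℕ × List ℕ) × List ℕ × ℕ × ℕ =>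
      (q.1.1, (q.1.2 ++ q.2.1).take q.2.2.1) :=
    (Primrec.fst.comp Primrec.fst).pair (Primrec.list_take.comp
      (Primrec.fst.comp (Primrec.snd.comp Primrec.snd))
      (Primrec.list_append.comp (Primrec.snd.comp Primrec.fst) (Primrec.fst.comp Primrec.snd)))
  obtain ⟨e, he, hspec⟩ := ComputableIn.exists_choice
    (p := fun (q : ℕ × List ℕ) (t : List ℕ × ℕ × ℕ) =>
      R (q.1, (q.2 ++ t.1).take t.2.1) t.2.2)
    (hR.comp harg.computableIn (Primrec.snd.comp (Primrec.snd.comp Primrec.snd)).computableIn) hex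
  have he' : ∀ m σ, ∃ ρ, W (m, ρ) ∧ ρ <+: σ ++ (e (m, σ)).1 := fun m σ =>
    ⟨_, (hWR _).2 ⟨_, hspec (m, σ)⟩, List.take_prefix _ _⟩
  -- Starting from `[0]` makes every extension nonempty. Index `k` treats the sets below `k`, hence
  -- the shift to `k + 1` in the operator returned.
  let E : ℕ → List ℕ → List ℕ := fun k σ => Nat.rec (motive := fun _ => List ℕ) [0]
    (fun m IH => IH ++ (e (m, σ ++ IH)).1) k
  have hsucc : ∀ k σ, E (k + 1) σ = E k σ ++ (e (k, σ ++ E k σ)).1 := fun _ _ => rfl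
  refine ⟨fun k => E (k + 1), ?_, fun k σ => ?_, fun k σ m hm => ?_⟩
  · refine ComputableIn.nat_rec (f := fun q : ℕ × List ℕ => q.1 + 1)
      (h := fun q r => r.2 ++ (e (r.1, q.2 ++ r.2)).1)
      (Primrec.succ.compIn ComputableIn.fst) (ComputableIn.const [0]) ?_
    have hr : Primrec fun t : (ℕ × List ℕ) × ℕ × List ℕ => t.2.2 :=
      Primrec.snd.comp Primrec.snd
    exact Primrec.list_append.compIn hr.computableIn (ComputableIn.fst.comp (he.comp
      ((Primrec.fst.comp Primrec.snd).pair
        (Primrec.list_append.comp (Primrec.snd.comp Primrec.fst) hr)).computableIn))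
  · have hnil : ∀ k, E k σ ≠ [] := fun k => by
      induction k with
      | zero => exact List.cons_ne_nil _ _
      | succ k ih => exact List.append_ne_nil_of_left_ne_nil ih _
    exact hnil (k + 1)
  · have hlt : ∀ k, ∀ m < k, ∃ ρ, W (m, ρ) ∧ ρ <+: σ ++ E k σ := fun k => by
      induction k with
      | zero => exact fun m hm => absurd hm m.not_lt_zero
      | succ k ih =>
        intro m hm
        rw [hsucc, ← List.append_assoc]
        rcases Nat.lt_succ_iff_lt_or_eq.1 hm with hm | rfl
        · obtain ⟨ρ, hρ, hpre⟩ := ih m hm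
          exact ⟨ρ, hρ, hpre.trans (List.prefix_append _ _)⟩
        · exact he' m _
    exact hlt (k + 1) m (Nat.lt_succ_of_le hm)

theorem WeaklyMeagerEngulfing.computesEventuallyDisagreeing (h : WeaklyMeagerEngulfing ℕ A) :
    ComputesEventuallyDisagreeing A := by
  by_contra H
  obtain ⟨S, ⟨C, ⟨W, hW, hC⟩, hnd, hS⟩, hall⟩ := h
  have hmem : ∀ {m x}, x ∉ C m ↔ ∃ ρ, W (m, ρ) ∧ x ∈ stringCylinder ρ := by
    intro m x
    rw [← Set.mem_compl_iff, hC m]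
    simp
  obtain ⟨E, hE, hne, hmeet⟩ := exists_extension_operators hW fun m σ => by
    obtain ⟨x, hxσ, hxC⟩ := (isNowhereDense_iff_of_compl_eq (hC m)).1 (hnd m) σ
    exact ⟨x, hxσ, hmem.1 hxC⟩
  obtain ⟨x, hx, hfreq⟩ := exists_computable_meeting H hE hne
  obtain ⟨m, hm⟩ := Set.mem_iUnion.1 (hS (hall x hx))
  -- Some meeting has index `k ≥ m`, and `E k` also enters the open set with index `m`.
  obtain ⟨k, hk, σ, hσ⟩ := frequently_atTop.1 hfreq m
  obtain ⟨ρ, hρ, hpre⟩ := hmeet k σ m hk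
  exact hmem.2 ⟨ρ, hρ, stringCylinder_subset_of_prefix hpre hσ⟩ hm

end GenericPoint

theorem theorem4p3 (A : Set ℕ) :
    List.TFAE [
      ComputesEventuallyDisagreeing A,
      WeaklyMeagerEngulfing Bool A,
      WeaklyMeagerEngulfing ℕ A] := by
  tfae_have 1 → 2 := ComputesEventuallyDisagreeing.weaklyMeagerEngulfing_bool
  tfae_have 2 → 3 := WeaklyMeagerEngulfing.nat_of_bool
  tfae_have 3 → 1 := WeaklyMeagerEngulfing.computesEventuallyDisagreeing
  tfae_finish
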